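/- Let $n\ge 0$. For a fixed-point-free involution $\pi$ of $\{1,\dots,2n\}$, call the pairs $(\alpha,\beta)$ with $\alpha<\beta$ and $\pi(\alpha)=\beta$ the chords of $\pi$; there are $n$ of them. Let $\Omega(\pi)$ be the unlabeled poset (that is, the isomorphism class of posets) formed by the chords of $\pi$ under the interval order $$(\alpha,\beta)<(\alpha',\beta')\iff \beta<\alpha'.$$ Say that $\pi$ has no neighbour nesting if every descent crosses the main diagonal: for every $1\le i<2n$, if $\pi(i)>\pi(i+1)$ then $\pi(i)>i\ge\pi(i+1)$ (equivalently, for no $i$ is one of the chords attached to $i$ and $i+1$ nested inside the other). A poset is $(\mathbf{2+2})$-free if it has no induced subposet isomorphic to the disjoint union of two $2$-element chains. **Theorem 7.1.** The map $\Omega$ restricts to a bijection from the set of fixed-point-free involutions of $\{1,\dots,2n\}$ with no neighbour nesting onto the set of unlabeled $(\mathbf{2+2})$-free posets on $n$ elements. -/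

import Mathlib

/-- Fixed-point-free involutions of the `2n` points `0 < 1 < ⋯ < 2n - 1`. -/
def FPFInvolution (n : ℕ) : Type :=
  {π : Equiv.Perm (Fin (2 * n)) // Function.Involutive π ∧ ∀ i, π i ≠ i}

/-- `π` has no neighbour nesting: every descent `π i > π (i + 1)` crosses the main diagonal,
that is, satisfies `π i > i ≥ π (i + 1)`. -/
def FPFInvolution.NoNeighbourNesting {n : ℕ} (π : FPFInvolution n) : Prop :=
  ∀ i j : Fin (2 * n), (j : ℕ) = (i : ℕ) + 1 → π.1 j < π.1 i → i < π.1 i ∧ π.1 j ≤ i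

/-- The chords of `π`: the transpositions `(a, b)` of `π`, written with `a < b`. -/
@[ext]
structure FPFInvolution.Chord {n : ℕ} (π : FPFInvolution n) where
  opening : Fin (2 * n)
  closing : Fin (2 * n)
  opening_lt_closing : opening < closing
  map_opening : π.1 opening = closing

/-- The interval order on the chords of `π`, each chord `(a, b)` being seen as the interval
`[a, b]`: `[a, b] < [c, d]` if and only if `b < c`. -/
instance FPFInvolution.Chord.instPartialOrder {n : ℕ} (π : FPFInvolution n) :
    PartialOrder π.Chord where
  le x y := x = y ∨ x.closing < y.opening
  lt x y := x.closing < y.opening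
  le_refl x := Or.inl rfl
  le_trans x y z hxy hyz := by
    rcases hxy with rfl | hxy
    · exact hyz
    · rcases hyz with rfl | hyz
      · exact Or.inr hxy
      · exact Or.inr (hxy.trans (y.opening_lt_closing.trans hyz))
  le_antisymm x y hxy hyx := by
    rcases hxy with h | hxy
    · exact h
    · rcases hyx with h | hyx
      · exact h.symm
      · exact absurd (hxy.trans (y.opening_lt_closing.trans (hyx.trans x.opening_lt_closing)))
          (lt_irrefl _)
  lt_iff_le_not_ge x y := by
    constructor
    · intro h
      refine ⟨Or.inr h, ?_⟩
      rintro (rfl | h')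
      · exact absurd (h.trans y.opening_lt_closing) (lt_irrefl _)
      · exact absurd (h.trans (y.opening_lt_closing.trans (h'.trans x.opening_lt_closing)))
          (lt_irrefl _)
    · rintro ⟨rfl | h, h'⟩
      · exact absurd (Or.inl rfl) h'
      · exact h

/-- A chord is determined by its opening point. -/
def FPFInvolution.chordEquiv {n : ℕ} (π : FPFInvolution n) :
    {i : Fin (2 * n) // i < π.1 i} ≃ π.Chord where
  toFun i := ⟨i.1, π.1 i.1, i.2, rfl⟩
  invFun c := ⟨c.opening, by rw [c.map_opening]; exact c.opening_lt_closing⟩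
  left_inv _ := rfl
  right_inv c := by ext <;> simp [c.map_opening]

instance FPFInvolution.Chord.instFintype {n : ℕ} (π : FPFInvolution n) : Fintype π.Chord :=
  Fintype.ofEquiv _ π.chordEquiv

theorem FPFInvolution.card_chord {n : ℕ} (π : FPFInvolution n) : Fintype.card π.Chord = n := by
  have e : {i : Fin (2 * n) // i < π.1 i} ≃ {i : Fin (2 * n) // ¬ i < π.1 i} :=
    π.1.subtypeEquiv fun i => by
      rw [π.2.1 i, not_lt]
      exact ⟨le_of_lt, fun h => lt_of_le_of_ne h (π.2.2 i).symm⟩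
  have h1 := Fintype.card_congr e
  have h2 := Fintype.card_congr (Equiv.sumCompl fun i : Fin (2 * n) => i < π.1 i)
  rw [Fintype.card_sum, ← h1, Fintype.card_fin] at h2
  rw [← Fintype.card_congr π.chordEquiv]
  omega

/-- Two partial orders on `Fin n` are equivalent if they are isomorphic as posets. -/
def posetIsoSetoid (n : ℕ) : Setoid (PartialOrder (Fin n)) where
  r P Q := Nonempty (@OrderIso (Fin n) (Fin n) P.toLE Q.toLE)
  iseqv :=
    { refl := fun P => ⟨@OrderIso.refl (Fin n) P.toLE⟩
      symm := fun {P Q} ⟨e⟩ => ⟨@OrderIso.symm (Fin n) (Fin n) P.toLE Q.toLE e⟩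
      trans := fun {P Q R} ⟨e⟩ ⟨f⟩ =>
        ⟨@OrderIso.trans (Fin n) (Fin n) (Fin n) P.toLE Q.toLE R.toLE e f⟩ }

/-- Unlabeled posets on `n` elements: isomorphism classes of posets with `n` elements. -/
def UnlabeledPoset (n : ℕ) : Type :=
  Quotient (posetIsoSetoid n)

/-- The isomorphism class of a finite poset with `n` elements
(it does not depend on the chosen numbering of the elements). -/
noncomputable def UnlabeledPoset.isoClass {n : ℕ} (α : Type*) [Fintype α] [PartialOrder α]
    (h : Fintype.card α = n) : UnlabeledPoset n :=
  Quotient.mk (posetIsoSetoid n)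
    (PartialOrder.lift (Fintype.equivFinOfCardEq h).symm (Equiv.injective _))

/-- A poset is (2+2)-free if it has no induced subposet isomorphic to the disjoint union
(no relations between the two summands) of two chains with two elements. -/
def TwoPlusTwoFree (α : Type*) [PartialOrder α] : Prop :=
  IsEmpty ((Fin 2 ⊕ Fin 2) ↪o α)

/-- An unlabeled poset is (2+2)-free if its representatives are. -/
def UnlabeledPoset.IsTwoPlusTwoFree {n : ℕ} (P : UnlabeledPoset n) : Prop :=
  Quotient.lift (s := posetIsoSetoid n) (fun Q => @TwoPlusTwoFree (Fin n) Q)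
    (by
      rintro P Q ⟨e⟩
      refine propext ⟨fun h => ⟨fun f => h.false ?_⟩, fun h => ⟨fun f => h.false ?_⟩⟩
      · exact @RelEmbedding.trans _ _ _ _ Q.le P.le f
          (@OrderIso.symm (Fin n) (Fin n) P.toLE Q.toLE e).toRelEmbedding
      · exact @RelEmbedding.trans _ _ _ _ P.le Q.le f e.toRelEmbedding) P

/-- The map `Ω`: it sends `π` to the unlabeled poset formed by the chords of `π`
under the interval order. -/
noncomputable def Omega (n : ℕ) (π : FPFInvolution n) : UnlabeledPoset n :=
  UnlabeledPoset.isoClass π.Chord π.card_chord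

/-! ### Isomorphism classes -/

/-! A finite (2+2)-free poset has a canonical interval representation: x becomes [`lowerLevel x`,
`upperLevel x`], and x < y exactly when `upperLevel x < lowerLevel y`
(`TwoPlusTwoFree.upperLevel_lt_lowerLevel_iff`). Isomorphisms preserve these levels.

Injectivity: without neighbour nesting, chords sorted by opening are sorted lexicographically by
levels (`NoNeighbourNesting.levels_mono`). Hence isomorphic chord posets give the same sequence of
levels, and this sequence fixes the relative order of all endpoints
(`NoNeighbourNesting.eq_of_orderIso`).

Surjectivity: sorting the endpoints of the canonical intervals by `endpointKey`, with ties broken so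
that no neighbours nest, gives the required involution (`exists_noNeighbourNesting_orderIso`). -/

theorem TwoPlusTwoFree.of_embedding {α β : Type*} [PartialOrder α] [PartialOrder β]
    (h : TwoPlusTwoFree α) (e : β ↪o α) : TwoPlusTwoFree β :=
  ⟨fun f => h.false (f.trans e)⟩

theorem twoPlusTwoFree_lift_iff {α β : Type*} [PartialOrder α] (e : β ≃ α) :
    @TwoPlusTwoFree β (PartialOrder.lift e e.injective) ↔ TwoPlusTwoFree α := by
  let _ : PartialOrder β := PartialOrder.lift e e.injective
  let f : β ≃o α := ⟨e, Iff.rfl⟩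
  exact ⟨fun h => h.of_embedding f.symm.toOrderEmbedding,
    fun h => h.of_embedding f.toOrderEmbedding⟩

theorem nonempty_orderIso_lift_iff {α β γ δ : Type*} [PartialOrder α] [PartialOrder β]
    (e : γ ≃ α) (f : δ ≃ β) :
    Nonempty (@OrderIso γ δ (PartialOrder.lift e e.injective).toLE
      (PartialOrder.lift f f.injective).toLE) ↔ Nonempty (α ≃o β) := by
  let _ : PartialOrder γ := PartialOrder.lift e e.injective
  let _ : PartialOrder δ := PartialOrder.lift f f.injective
  let e' : γ ≃o α := ⟨e, Iff.rfl⟩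
  let f' : δ ≃o β := ⟨f, Iff.rfl⟩
  exact ⟨fun ⟨g⟩ => ⟨(e'.symm.trans g).trans f'⟩, fun ⟨g⟩ => ⟨(e'.trans g).trans f'.symm⟩⟩

theorem UnlabeledPoset.isTwoPlusTwoFree_isoClass {n : ℕ} (α : Type*) [Fintype α] [PartialOrder α]
    (h : Fintype.card α = n) :
    (UnlabeledPoset.isoClass α h).IsTwoPlusTwoFree ↔ TwoPlusTwoFree α :=
  twoPlusTwoFree_lift_iff (Fintype.equivFinOfCardEq h).symm

theorem UnlabeledPoset.isoClass_eq_iff {n : ℕ} {α β : Type*} [Fintype α] [PartialOrder α]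
    [Fintype β] [PartialOrder β] (hα : Fintype.card α = n) (hβ : Fintype.card β = n) :
    UnlabeledPoset.isoClass α hα = UnlabeledPoset.isoClass β hβ ↔ Nonempty (α ≃o β) :=
  (Quotient.eq (r := posetIsoSetoid n)).trans (nonempty_orderIso_lift_iff
    (Fintype.equivFinOfCardEq hα).symm (Fintype.equivFinOfCardEq hβ).symm)

theorem UnlabeledPoset.exists_rep {n : ℕ} (P : UnlabeledPoset n) :
    ∃ Q : PartialOrder (Fin n),
      @UnlabeledPoset.isoClass n (Fin n) _ Q (Fintype.card_fin n) = P := by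
  obtain ⟨Q, rfl⟩ := Quotient.exists_rep P
  exact ⟨Q, Quotient.sound
    ⟨@RelIso.mk _ _ (_) Q.le (Fintype.equivFinOfCardEq (Fintype.card_fin n)).symm Iff.rfl⟩⟩

/-! ### The levels of the endpoints in a finite poset -/

section Levels

variable {α : Type*} [PartialOrder α] [Fintype α]

open Classical in
/-- The number of elements strictly below `x`. -/
noncomputable def lowerLevel (x : α) : ℕ :=
  (Finset.univ.filter fun y => y < x).card

open Classical in
/-- The largest lower level of an element that is not strictly above `x`. -/
noncomputable def upperLevel (x : α) : ℕ :=
  (Finset.univ.filter fun z => ¬ x < z).sup lowerLevel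

theorem lowerLevel_mono {x y : α} (h : ∀ z, z < x → z < y) : lowerLevel x ≤ lowerLevel y := by
  classical
  exact Finset.card_le_card fun z hz => by simp_all

theorem lowerLevel_lt {x y z : α} (h : ∀ z, z < x → z < y) (hx : ¬ z < x) (hy : z < y) :
    lowerLevel x < lowerLevel y := by
  classical
  refine Finset.card_lt_card ⟨fun z hz => by simp_all, fun hs => hx ?_⟩
  have : z ∈ Finset.univ.filter fun w => w < y := by simpa using hy
  simpa using hs this

theorem exists_of_lowerLevel_lt {x y : α} (h : lowerLevel x < lowerLevel y) :
    ∃ z, ¬ z < x ∧ z < y := by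
  by_contra! H
  exact h.not_ge (lowerLevel_mono fun z hz => by_contra fun hzx => H z hzx hz)

theorem lowerLevel_le_upperLevel {x z : α} (h : ¬ x < z) : lowerLevel z ≤ upperLevel x := by
  classical
  exact Finset.le_sup (f := lowerLevel) (by simpa using h)

theorem exists_lowerLevel_eq_upperLevel (x : α) :
    ∃ z, ¬ x < z ∧ upperLevel x = lowerLevel z := by
  classical
  obtain ⟨z, hz, h⟩ := Finset.exists_mem_eq_sup (Finset.univ.filter fun z => ¬ x < z)
    ⟨x, by simp⟩ lowerLevel
  exact ⟨z, by simpa using hz, h⟩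

theorem upperLevel_mono {x y : α} (h : ∀ z, y < z → x < z) : upperLevel x ≤ upperLevel y := by
  obtain ⟨z, hz, e⟩ := exists_lowerLevel_eq_upperLevel x
  exact e ▸ lowerLevel_le_upperLevel fun hy => hz (h z hy)

theorem lowerLevel_orderIso {β : Type*} [PartialOrder β] [Fintype β] (e : α ≃o β) (x : α) :
    lowerLevel (e x) = lowerLevel x := by
  classical
  refine (Finset.card_equiv e.toEquiv fun y => ?_).symm
  simp

theorem upperLevel_orderIso {β : Type*} [PartialOrder β] [Fintype β] (e : α ≃o β) (x : α) :
    upperLevel (e x) = upperLevel x := by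
  apply le_antisymm
  · obtain ⟨z, hz, h⟩ := exists_lowerLevel_eq_upperLevel (e x)
    obtain ⟨w, rfl⟩ := e.surjective z
    rw [h, lowerLevel_orderIso]
    exact lowerLevel_le_upperLevel fun hw => hz (e.lt_iff_lt.2 hw)
  · obtain ⟨z, hz, h⟩ := exists_lowerLevel_eq_upperLevel x
    rw [h, ← lowerLevel_orderIso e]
    exact lowerLevel_le_upperLevel fun hw => hz (e.lt_iff_lt.1 hw)

theorem TwoPlusTwoFree.lt_or_lt {β : Type*} [PartialOrder β] (h : TwoPlusTwoFree β)
    {a b c d : β} (hab : a < b) (hcd : c < d) : a < d ∨ c < b := by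
  by_contra! H
  obtain ⟨had, hcb⟩ := H
  have hac : ¬ a ≤ c := fun h => had (h.trans_lt hcd)
  have hca : ¬ c ≤ a := fun h => hcb (h.trans_lt hab)
  have hbd : ¬ b ≤ d := fun h => had (hab.trans_le h)
  have hdb : ¬ d ≤ b := fun h => hcb (hcd.trans_le h)
  have had' : ¬ a ≤ d := fun h => h.lt_or_eq.elim had fun e => hcb (e ▸ hcd |>.trans hab)
  have hcb' : ¬ c ≤ b := fun h => h.lt_or_eq.elim hcb fun e => had (e ▸ hab |>.trans hcd)
  have hda : ¬ d ≤ a := fun h => hcb (hcd.trans_le h |>.trans hab)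
  have hbc : ¬ b ≤ c := fun h => had (hab.trans_le h |>.trans hcd)
  refine h.false (OrderEmbedding.ofMapLEIff (Sum.elim ![a, b] ![c, d]) ?_)
  rintro (i | i) (j | j) <;> fin_cases i <;> fin_cases j <;>
    simp [hab.le, hcd.le, hab.not_ge, hcd.not_ge, *]

/-- Only the direction from x < y needs (2+2)-freeness. If z attains `upperLevel x`, then `lt_or_lt`
puts everything below z below y, and x itself is below y but not below z. -/
theorem TwoPlusTwoFree.upperLevel_lt_lowerLevel_iff (h : TwoPlusTwoFree α) {x y : α} :
    upperLevel x < lowerLevel y ↔ x < y := by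
  refine ⟨fun hl => by_contra fun hxy => hl.not_ge (lowerLevel_le_upperLevel hxy), fun hxy => ?_⟩
  obtain ⟨z, hz, e⟩ := exists_lowerLevel_eq_upperLevel x
  rw [e]
  exact lowerLevel_lt (fun w hw => (h.lt_or_lt hw hxy).resolve_right hz) hz hxy

end Levels

/-! ### Sorting a finite type by an injective key -/

theorem exists_equiv_fin_strictMono {β K : Type*} [Fintype β] [LinearOrder K] {N : ℕ}
    (hN : Fintype.card β = N) (key : β → K) (hkey : Function.Injective key) :
    ∃ e : Fin N ≃ β, StrictMono (key ∘ e) := by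
  classical
  let i := Finset.orderIsoOfFin (Finset.univ.image key) (k := N)
    (by rw [Finset.card_image_of_injective _ hkey, Finset.card_univ, hN])
  have hi : ∀ k, ∃ b, key b = i k := fun k => by
    simpa only [Finset.mem_image, Finset.mem_univ, true_and] using (i k).2
  choose e he using hi
  have hmono : StrictMono (key ∘ e) := fun a b hab => by
    simpa [he] using hab
  have hb : Function.Bijective e := (Fintype.bijective_iff_injective_and_card e).2
    ⟨hmono.injective.of_comp, by simp [hN]⟩
  exact ⟨Equiv.ofBijective e hb, hmono⟩

namespace FPFInvolution

/-! ### Interval orders of chords -/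

section Chords

variable {n : ℕ} {π : FPFInvolution n}

theorem Chord.lt_iff {x y : π.Chord} : x < y ↔ x.closing < y.opening := Iff.rfl

theorem Chord.map_closing (x : π.Chord) : π.1 x.closing = x.opening := by
  rw [← x.map_opening, π.2.1]

theorem Chord.opening_injective : Function.Injective (Chord.opening (π := π)) := fun x y h => by
  ext1
  · exact h
  · rw [← x.map_opening, ← y.map_opening, h]

theorem Chord.closing_injective : Function.Injective (Chord.closing (π := π)) := fun x y h =>
  Chord.opening_injective (by rw [← x.map_closing, ← y.map_closing, h])

theorem Chord.opening_ne_closing (x y : π.Chord) : x.opening ≠ y.closing := fun h => by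
  have hx := x.opening_lt_closing
  have hy := y.opening_lt_closing
  rw [← x.map_opening, h, y.map_closing] at hx
  exact hx.asymm hy

theorem exists_opening_eq {i : Fin (2 * n)} (h : i < π.1 i) : ∃ x : π.Chord, x.opening = i :=
  ⟨⟨i, π.1 i, h, rfl⟩, rfl⟩

theorem exists_closing_eq {i : Fin (2 * n)} (h : π.1 i < i) : ∃ x : π.Chord, x.closing = i :=
  ⟨⟨π.1 i, i, h, π.2.1 i⟩, rfl⟩

theorem twoPlusTwoFree_chord (π : FPFInvolution n) : TwoPlusTwoFree π.Chord := by
  refine ⟨fun f => ?_⟩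
  have h1 : f (Sum.inl 0) < f (Sum.inl 1) := f.lt_iff_lt.2 (by simp)
  have h2 : f (Sum.inr 0) < f (Sum.inr 1) := f.lt_iff_lt.2 (by simp)
  have h3 : ¬ f (Sum.inl 0) < f (Sum.inr 1) := fun h => by simp [f.lt_iff_lt] at h
  have h4 : ¬ f (Sum.inr 0) < f (Sum.inl 1) := fun h => by simp [f.lt_iff_lt] at h
  rw [Chord.lt_iff] at *
  -- For chains a < b and c < d without cross relations, the endpoints would form a cycle: closing a
  -- < opening b ≤ closing c < opening d ≤ closing a.
  exact absurd (h1.trans_le ((not_lt.1 h4).trans (h2.le.trans (not_lt.1 h3)))) (lt_irrefl _)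

/-- A descent at neighbouring points is an opening followed by a closing, which `hrun` forbids; so
`π` increases at every step from `i` to `j`. Runs without an interior closing or without an interior
opening both qualify. -/
theorem NoNeighbourNesting.lt_of_run (h : π.NoNeighbourNesting) {i j : Fin (2 * n)}
    (hij : i < j)
    (hrun : ∀ k l, i ≤ k → k < l → l ≤ j → ¬ (k < π.1 k ∧ π.1 l < l)) : π.1 i < π.1 j := by
  have step : ∀ k l : Fin (2 * n), (l : ℕ) = k + 1 → i ≤ k → l ≤ j → π.1 k < π.1 l := by
    intro k l hkl hik hlj
    have hlt : k < l := by rw [Fin.lt_def]; omega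
    by_contra hlt'
    have hne : π.1 l ≠ π.1 k := fun e => hlt.ne' (π.1.injective e)
    obtain ⟨h1, h2⟩ := h k l hkl (lt_of_le_of_ne (not_lt.1 hlt') hne)
    exact hrun k l hik hlt hlj ⟨h1, h2.trans_lt hlt⟩
  have chain : ∀ m : ℕ, (i : ℕ) + 1 ≤ m → ∀ hm : m < 2 * n, m ≤ j → π.1 i < π.1 ⟨m, hm⟩ := by
    intro m him
    induction m, him using Nat.le_induction with
    | base => exact fun hm hmj => step i ⟨i + 1, hm⟩ rfl le_rfl hmj
    | succ m him ih =>
      intro hm hmj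
      exact (ih (by omega) (by omega)).trans
        (step ⟨m, by omega⟩ ⟨m + 1, hm⟩ rfl (by rw [Fin.le_def]; simp only; omega) hmj)
  exact chain j hij j.2 le_rfl

theorem NoNeighbourNesting.closing_lt_closing (h : π.NoNeighbourNesting) {x y : π.Chord}
    (hxy : x.opening < y.opening)
    (hrun : ∀ z : π.Chord, x.opening < z.closing → ¬ z.closing < y.opening) :
    x.closing < y.closing := by
  rw [← x.map_opening, ← y.map_opening]
  refine h.lt_of_run hxy fun k l hk hkl hl ⟨_, hlt⟩ => ?_
  obtain ⟨z, rfl⟩ := exists_closing_eq hlt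
  exact hrun z (hk.trans_lt hkl) (lt_of_le_of_ne hl (Chord.opening_ne_closing y z).symm)

theorem NoNeighbourNesting.opening_lt_opening (h : π.NoNeighbourNesting) {x y : π.Chord}
    (hxy : x.closing < y.closing)
    (hrun : ∀ z : π.Chord, x.closing < z.opening → ¬ z.opening < y.closing) :
    x.opening < y.opening := by
  rw [← x.map_closing, ← y.map_closing]
  refine h.lt_of_run hxy fun k l hk hkl hl ⟨hlt, _⟩ => ?_
  obtain ⟨z, rfl⟩ := exists_opening_eq hlt
  exact hrun z (lt_of_le_of_ne hk (Chord.opening_ne_closing z x).symm) (hkl.trans_le hl)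

theorem Chord.upperLevel_lt_lowerLevel_iff {x y : π.Chord} :
    upperLevel x < lowerLevel y ↔ x < y :=
  π.twoPlusTwoFree_chord.upperLevel_lt_lowerLevel_iff

theorem Chord.lowerLevel_le {x y : π.Chord} (hxy : x.opening ≤ y.opening) :
    lowerLevel x ≤ lowerLevel y :=
  lowerLevel_mono fun _ hz => Chord.lt_iff.2 ((Chord.lt_iff.1 hz).trans_le hxy)

theorem Chord.upperLevel_le {x y : π.Chord} (hxy : x.closing ≤ y.closing) :
    upperLevel x ≤ upperLevel y :=
  upperLevel_mono fun _ hz => Chord.lt_iff.2 (hxy.trans_lt (Chord.lt_iff.1 hz))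

/-- A closing between the two openings would belong to a chord below `y` but not below `x`,
separating the lower levels. -/
theorem NoNeighbourNesting.closing_lt_of_lowerLevel_eq (h : π.NoNeighbourNesting) {x y : π.Chord}
    (hxy : x.opening < y.opening) (hl : lowerLevel x = lowerLevel y) :
    x.closing < y.closing :=
  h.closing_lt_closing hxy fun _ hxz hzy => hl.not_lt
    (lowerLevel_lt (fun _ hw => (Chord.lt_iff.1 hw).trans hxy) (not_lt.2 hxz.le) hzy)

/-- An opening between the two closings would belong to a chord above `x` but not above `y`, whose
lower level would separate the upper levels. -/
theorem NoNeighbourNesting.opening_lt_of_upperLevel_eq (h : π.NoNeighbourNesting) {x y : π.Chord}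
    (hxy : x.closing < y.closing) (hu : upperLevel x = upperLevel y) :
    x.opening < y.opening :=
  h.opening_lt_opening hxy fun _ hxz hzy =>
    (Chord.upperLevel_lt_lowerLevel_iff.2 hxz).not_ge
      (hu ▸ lowerLevel_le_upperLevel (not_lt.2 hzy.le))

/-- The pair of levels of a chord, ordered lexicographically. -/
noncomputable def Chord.levels (x : π.Chord) : ℕ ×ₗ ℕ :=
  toLex (lowerLevel x, upperLevel x)

theorem NoNeighbourNesting.levels_mono (h : π.NoNeighbourNesting) {x y : π.Chord}
    (hxy : x.opening ≤ y.opening) : x.levels ≤ y.levels := by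
  rcases hxy.lt_or_eq with hlt | he
  · rw [Chord.levels, Chord.levels, Prod.Lex.toLex_le_toLex]
    rcases (Chord.lowerLevel_le hxy).lt_or_eq with hl | hl
    · exact Or.inl hl
    · exact Or.inr ⟨hl, Chord.upperLevel_le (h.closing_lt_of_lowerLevel_eq hlt hl).le⟩
  · rw [Chord.opening_injective he]

theorem Chord.levels_eq_iff {σ : FPFInvolution n} {x : π.Chord} {y : σ.Chord} :
    x.levels = y.levels ↔ lowerLevel x = lowerLevel y ∧ upperLevel x = upperLevel y := by
  simp [Chord.levels]

/-! ### Involutions without neighbour nesting are determined by their chord posets -/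

/-- Isomorphic chord posets can be matched compatibly with the order of the openings. -/
theorem NoNeighbourNesting.exists_equiv {σ : FPFInvolution n} (hπ : π.NoNeighbourNesting)
    (hσ : σ.NoNeighbourNesting) (φ : π.Chord ≃o σ.Chord) :
    ∃ ψ : π.Chord ≃ σ.Chord, (∀ x y, x.opening < y.opening → (ψ x).opening < (ψ y).opening) ∧
      ∀ x, (ψ x).levels = x.levels := by
  obtain ⟨e, he⟩ := exists_equiv_fin_strictMono π.card_chord _ (Chord.opening_injective (π := π))
  obtain ⟨f, hf⟩ := exists_equiv_fin_strictMono σ.card_chord _ (Chord.opening_injective (π := σ))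
  have hlev : ∀ y : σ.Chord, (φ.symm y).levels = y.levels := fun y =>
    Chord.levels_eq_iff.2 ⟨lowerLevel_orderIso φ.symm y, upperLevel_orderIso φ.symm y⟩
  let τ : Equiv.Perm (Fin n) := (f.trans φ.symm.toEquiv).trans e.symm
  have hτ : ∀ k, (e (τ k)).levels = (f k).levels := fun k => by simp [τ, hlev]
  -- A finite family has only one sorted rearrangement, so the k-th chords of `π` and `σ` have equal
  -- levels. The map `φ` itself will not do, since it may permute chords with equal levels.
  have key := Tuple.unique_monotone (f := Chord.levels ∘ e) (σ := τ) (τ := Equiv.refl _)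
    (fun a b hab => by
      simp only [Function.comp_apply, hτ]
      exact hσ.levels_mono (hf.monotone hab))
    (fun a b hab => hπ.levels_mono (he.monotone hab))
  refine ⟨e.symm.trans f, fun x y hxy => hf ?_, fun x => ?_⟩
  · exact he.lt_iff_lt.1 (by simpa using hxy)
  · have := congrFun key (e.symm x)
    simpa [hτ] using this

/-- The endpoints of the chords are all the points. -/
noncomputable def endpointEquiv (π : FPFInvolution n) : π.Chord ⊕ π.Chord ≃ Fin (2 * n) :=
  Equiv.ofBijective (Sum.elim Chord.opening Chord.closing)
    ⟨Chord.opening_injective.sumElim Chord.closing_injective Chord.opening_ne_closing, fun i => by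
      rcases lt_or_gt_of_ne (π.2.2 i) with h | h
      · obtain ⟨x, hx⟩ := exists_closing_eq h
        exact ⟨Sum.inr x, hx⟩
      · obtain ⟨x, hx⟩ := exists_opening_eq h
        exact ⟨Sum.inl x, hx⟩⟩

/-- The induced permutation of the points is increasing, hence the identity. -/
theorem eq_of_equiv {σ : FPFInvolution n} (ψ : π.Chord ≃ σ.Chord)
    (hoo : ∀ x y, x.opening < y.opening → (ψ x).opening < (ψ y).opening)
    (hoc : ∀ x y, x.opening < y.closing → (ψ x).opening < (ψ y).closing)
    (hco : ∀ x y, x.closing < y.opening → (ψ x).closing < (ψ y).opening)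
    (hcc : ∀ x y, x.closing < y.closing → (ψ x).closing < (ψ y).closing) : π = σ := by
  let g : Fin (2 * n) ≃ Fin (2 * n) :=
    (π.endpointEquiv.symm.trans (Equiv.sumCongr ψ ψ)).trans σ.endpointEquiv
  have hg : StrictMono g := by
    intro i j hij
    obtain ⟨a, rfl⟩ := π.endpointEquiv.surjective i
    obtain ⟨b, rfl⟩ := π.endpointEquiv.surjective j
    simp only [g, Equiv.trans_apply, Equiv.symm_apply_apply]
    rcases a with x | x <;> rcases b with y | y
    · exact hoo x y hij
    · exact hoc x y hij
    · exact hco x y hij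
    · exact hcc x y hij
  have hid : ∀ i, g i = i := fun i =>
    DFunLike.congr_fun (Subsingleton.elim (hg.orderIsoOfSurjective g g.surjective)
      (OrderIso.refl _)) i
  have hop : ∀ x, (ψ x).opening = x.opening := fun x => by
    have := hid (π.endpointEquiv (Sum.inl x))
    simp only [g, Equiv.trans_apply, Equiv.symm_apply_apply] at this
    exact this
  have hcl : ∀ x, (ψ x).closing = x.closing := fun x => by
    have := hid (π.endpointEquiv (Sum.inr x))
    simp only [g, Equiv.trans_apply, Equiv.symm_apply_apply] at this
    exact this
  refine Subtype.ext (Equiv.ext fun i => ?_)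
  obtain ⟨x | x, rfl⟩ := π.endpointEquiv.surjective i
  · change π.1 x.opening = σ.1 x.opening
    rw [x.map_opening, ← hop, (ψ x).map_opening, hcl]
  · change π.1 x.closing = σ.1 x.closing
    rw [x.map_closing, ← hcl, (ψ x).map_closing, hop]

theorem NoNeighbourNesting.eq_of_orderIso {σ : FPFInvolution n} (hπ : π.NoNeighbourNesting)
    (hσ : σ.NoNeighbourNesting) (φ : π.Chord ≃o σ.Chord) : π = σ := by
  obtain ⟨ψ, hop, hlev⟩ := hπ.exists_equiv hσ φ
  have hl : ∀ x, lowerLevel (ψ x) = lowerLevel x := fun x => (Chord.levels_eq_iff.1 (hlev x)).1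
  have hu : ∀ x, upperLevel (ψ x) = upperLevel x := fun x => (Chord.levels_eq_iff.1 (hlev x)).2
  have hlt : ∀ x y, ψ x < ψ y ↔ x < y := fun x y => by
    rw [← Chord.upperLevel_lt_lowerLevel_iff, hl, hu, Chord.upperLevel_lt_lowerLevel_iff]
  refine eq_of_equiv ψ hop (fun x y hxy => ?_) (fun x y hxy => (hlt x y).2 hxy)
    fun x y hxy => ?_
  · refine lt_of_le_of_ne (not_lt.1 fun h => ?_) (Chord.opening_ne_closing _ _)
    exact hxy.asymm ((hlt y x).1 h)
  -- Upper levels decide the order of the closings; when they tie, closings are ordered like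
  -- openings in both `π` and `σ`.
  · by_contra hlt'
    have hle := Chord.upperLevel_le (not_lt.1 hlt')
    rw [hu, hu] at hle
    have he := le_antisymm (Chord.upperLevel_le hxy.le) hle
    have h1 := hop x y (hπ.opening_lt_of_upperLevel_eq hxy he)
    rcases (not_lt.1 hlt').lt_or_eq with h2 | h2
    · exact h1.asymm (hσ.opening_lt_of_upperLevel_eq h2 (by rw [hu, hu, he]))
    · exact h1.ne' (congrArg Chord.opening (Chord.closing_injective h2))

end Chords

/-! ### Every finite (2+2)-free poset is the chord poset of such an involution -/

section Construction

variable {α : Type*}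

/-- The involution that exchanges the two copies of `α`, transported along a numbering. -/
def ofEquiv {n : ℕ} (e : Fin (2 * n) ≃ α ⊕ α) : FPFInvolution n :=
  ⟨(e.trans (Equiv.sumComm α α)).trans e.symm, fun i => by simp, fun i h => by
    have h' : (e i).swap = e i := by simpa [Equiv.symm_apply_eq] using h
    rcases hi : e i with x | x <;> simp [hi] at h'⟩

theorem ofEquiv_apply {n : ℕ} (e : Fin (2 * n) ≃ α ⊕ α) (i : Fin (2 * n)) :
    (ofEquiv e).1 i = e.symm (e i).swap := rfl

/-- If the left copy of each element precedes its right copy, then the elements are the chords. -/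
def chordOfEquiv {n : ℕ} (e : Fin (2 * n) ≃ α ⊕ α)
    (he : ∀ x, e.symm (Sum.inl x) < e.symm (Sum.inr x)) (x : α) : (ofEquiv e).Chord :=
  ⟨e.symm (Sum.inl x), e.symm (Sum.inr x), he x, by simp [ofEquiv_apply]⟩

theorem chordOfEquiv_bijective {n : ℕ} (e : Fin (2 * n) ≃ α ⊕ α)
    (he : ∀ x, e.symm (Sum.inl x) < e.symm (Sum.inr x)) :
    Function.Bijective (chordOfEquiv e he) := by
  constructor
  · intro x y h
    have := congrArg Chord.opening h
    simpa [chordOfEquiv] using this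
  · intro c
    have hc := c.opening_lt_closing
    have hm := c.map_opening
    rw [ofEquiv_apply] at hm
    rcases hi : e c.opening with x | x
    · exact ⟨x, Chord.opening_injective ((Equiv.symm_apply_eq e).2 hi.symm)⟩
    · rw [← hm, hi, ← (Equiv.symm_apply_eq e).2 hi.symm] at hc
      exact absurd (he x) hc.asymm

variable [PartialOrder α] [Fintype α] {T : Type*}

/-- The key by which the endpoints are sorted: by level, at each level the openings before the
closings, then by the level of the other endpoint, then by a label. -/
noncomputable def endpointKey (t : α → T) : α ⊕ α → ℕ ×ₗ ℕ ×ₗ T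
  | Sum.inl x => toLex (2 * lowerLevel x, toLex (upperLevel x, t x))
  | Sum.inr x => toLex (2 * upperLevel x + 1, toLex (lowerLevel x, t x))

theorem endpointKey_injective {t : α → T} (ht : Function.Injective t) :
    Function.Injective (endpointKey t) := by
  rintro (x | x) (y | y) h <;>
    simp only [endpointKey, EmbeddingLike.apply_eq_iff_eq, Prod.mk.injEq] at h
  · rw [ht h.2.2]
  · omega
  · omega
  · rw [ht h.2.2]

variable [LinearOrder T]

theorem endpointKey_inr_lt_inl {t : α → T} {x y : α} :
    endpointKey t (Sum.inr x) < endpointKey t (Sum.inl y) ↔ upperLevel x < lowerLevel y := by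
  simp only [endpointKey, Prod.Lex.toLex_lt_toLex]
  omega

theorem endpointKey_inl_lt_inr {t : α → T} {x y : α} :
    endpointKey t (Sum.inl x) < endpointKey t (Sum.inr y) ↔ lowerLevel x ≤ upperLevel y := by
  simp only [endpointKey, Prod.Lex.toLex_lt_toLex]
  omega

theorem endpointKey_inl_lt_inl {t : α → T} {x y : α} :
    endpointKey t (Sum.inl x) < endpointKey t (Sum.inl y) ↔ lowerLevel x < lowerLevel y ∨
      lowerLevel x = lowerLevel y ∧ toLex (upperLevel x, t x) < toLex (upperLevel y, t y) := by
  simp only [endpointKey, Prod.Lex.toLex_lt_toLex (α := ℕ) (β := ℕ ×ₗ T)]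
  refine or_congr (by omega) (and_congr_left fun _ => by omega)

theorem endpointKey_inr_lt_inr {t : α → T} {x y : α} :
    endpointKey t (Sum.inr x) < endpointKey t (Sum.inr y) ↔ upperLevel x < upperLevel y ∨
      upperLevel x = upperLevel y ∧ toLex (lowerLevel x, t x) < toLex (lowerLevel y, t y) := by
  simp only [endpointKey, Prod.Lex.toLex_lt_toLex (α := ℕ) (β := ℕ ×ₗ T)]
  refine or_congr (by omega) (and_congr_left fun _ => by omega)

theorem exists_noNeighbourNesting_orderIso {n : ℕ} (hn : Fintype.card α = n)
    (h : TwoPlusTwoFree α) : ∃ π : FPFInvolution n, π.NoNeighbourNesting ∧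
      Nonempty (α ≃o π.Chord) := by
  -- The same labels break ties among openings and among closings, so chords with equal levels never
  -- nest.
  let t := Fintype.equivFinOfCardEq hn
  obtain ⟨e, hmono⟩ := exists_equiv_fin_strictMono (N := 2 * n) (by simp [hn, two_mul])
    (endpointKey t) (endpointKey_injective t.injective)
  have hlt : ∀ {a b}, e.symm a < e.symm b ↔ endpointKey t a < endpointKey t b := fun {a b} => by
    simpa using (hmono.lt_iff_lt (a := e.symm a) (b := e.symm b)).symm
  have hself : ∀ x : α, lowerLevel x ≤ upperLevel x := fun x =>
    lowerLevel_le_upperLevel (lt_irrefl x)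
  have he : ∀ x, e.symm (Sum.inl x) < e.symm (Sum.inr x) := fun x =>
    hlt.2 (endpointKey_inl_lt_inr.2 (hself x))
  have hiff : ∀ {x y}, chordOfEquiv e he x < chordOfEquiv e he y ↔ x < y := fun {x y} => by
    refine Iff.trans (hlt.trans endpointKey_inr_lt_inl) h.upperLevel_lt_lowerLevel_iff
  refine ⟨ofEquiv e, fun i j hij hdesc => ?_, ⟨OrderIso.ofRelIsoLT
    ⟨Equiv.ofBijective _ (chordOfEquiv_bijective e he), hiff⟩⟩⟩
  obtain ⟨a, rfl⟩ := e.symm.surjective i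
  obtain ⟨b, rfl⟩ := e.symm.surjective j
  have hab := hlt.1 (show e.symm a < e.symm b by rw [Fin.lt_def]; omega)
  have hnone : ∀ c, endpointKey t a < endpointKey t c → ¬ endpointKey t c < endpointKey t b :=
    fun c hac hcb => by
      have h1 := hlt.2 hac
      have h2 := hlt.2 hcb
      rw [Fin.lt_def] at h1 h2
      omega
  simp only [ofEquiv_apply, Equiv.apply_symm_apply] at hdesc ⊢
  rw [hlt] at hdesc
  rcases a with x | x <;> rcases b with y | y <;> simp only [Sum.swap_inl, Sum.swap_inr] at hdesc ⊢
  · rw [endpointKey_inl_lt_inl] at hab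
    rcases hab with hab | ⟨hd, hk⟩
    -- The closing of z would lie strictly between the two neighbouring openings.
    · obtain ⟨z, hzx, hzy⟩ := exists_of_lowerLevel_lt hab
      exact absurd (endpointKey_inr_lt_inl.2 (h.upperLevel_lt_lowerLevel_iff.2 hzy))
        (hnone _ (endpointKey_inl_lt_inr.2 (lowerLevel_le_upperLevel hzx)))
    · refine absurd (endpointKey_inr_lt_inr.2 ?_) hdesc.asymm
      simp only [Prod.Lex.toLex_lt_toLex] at hk ⊢
      exact hk.imp_right fun hk => ⟨hk.1, Or.inr ⟨hd, hk.2⟩⟩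
  · refine ⟨he x, ?_⟩
    have h1 := he y
    rw [Fin.lt_def] at h1
    rw [Fin.le_def]
    omega
  -- Here x < y, so the partners ascend.
  · rw [endpointKey_inr_lt_inl] at hab
    rw [endpointKey_inr_lt_inl] at hdesc
    have := hself x
    have := hself y
    omega
  · rw [endpointKey_inr_lt_inr] at hab
    rcases hab with hab | ⟨hd, hk⟩
    -- The opening of an element attaining `upperLevel y` would lie strictly between the two
    -- neighbouring closings.
    · obtain ⟨z, hz, hyz⟩ := exists_lowerLevel_eq_upperLevel y
      exact absurd (endpointKey_inl_lt_inr.2 hyz.ge)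
        (hnone (Sum.inl z) (endpointKey_inr_lt_inl.2 (hyz ▸ hab)))
    · refine absurd (endpointKey_inl_lt_inl.2 ?_) hdesc.asymm
      simp only [Prod.Lex.toLex_lt_toLex] at hk ⊢
      exact hk.imp_right fun hk => ⟨hk.1, Or.inr ⟨hd, hk.2⟩⟩

end Construction

end FPFInvolution

theorem theorem7p1 (n : ℕ) :
    Set.BijOn (Omega n)
      {π : FPFInvolution n | π.NoNeighbourNesting}
      {P : UnlabeledPoset n | P.IsTwoPlusTwoFree} := by
  refine ⟨fun π _ => ?_, fun π hπ σ hσ h => ?_, fun P hP => ?_⟩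
  · exact (UnlabeledPoset.isTwoPlusTwoFree_isoClass _ _).2 π.twoPlusTwoFree_chord
  · obtain ⟨φ⟩ := (UnlabeledPoset.isoClass_eq_iff _ _).1 h
    exact FPFInvolution.NoNeighbourNesting.eq_of_orderIso hπ hσ φ
  · obtain ⟨Q, rfl⟩ := P.exists_rep
    have hQ := (UnlabeledPoset.isTwoPlusTwoFree_isoClass _ _).1 hP
    obtain ⟨π, hπ, ⟨e⟩⟩ :=
      FPFInvolution.exists_noNeighbourNesting_orderIso (Fintype.card_fin n) hQ
    exact ⟨π, hπ, ((UnlabeledPoset.isoClass_eq_iff _ _).2 ⟨e⟩).symm⟩
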